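/- Let $\rho_0=U\,\mathrm{diag}(\lambda)\,U^\top$ be a real $n\times n$ density matrix (symmetric positive semidefinite with trace $1$), where $U$ is orthogonal with columns $u_1,\dots,u_n$ and $\lambda_1\ge\lambda_2\ge\cdots\ge\lambda_n$, and let $1\le k\le \mathrm{rank}(\rho_0)$ (equivalently, $1\le k\le n$ and $\lambda_k>0$). For density matrices $\rho_1,\rho_2$ let the Bures distance $D_B(\rho_1,\rho_2)\ge 0$ be given by $$D_B^2(\rho_1,\rho_2)=2\Bigl(1-\mathrm{tr}\sqrt{\rho_1^{1/2}\rho_2\,\rho_1^{1/2}}\Bigr).$$ Then the matrix $$\bar\rho_0^k=\frac{\sum_{i=1}^k\lambda_i u_iu_i^\top}{\sum_{i=1}^k\lambda_i}$$ is a density matrix of rank $k$, and it minimizes $D_B(\rho,\rho_0)$ over all real $n\times n$ density matrices $\rho$ with $\mathrm{rank}(\rho)=k$. Moreover, if $k=n$ or $\lambda_k>\lambda_{k+1}$, it is the only minimizer. -/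

import Mathlib

open scoped MatrixOrder

/-- Real density matrices: symmetric positive semidefinite with unit trace. -/
structure IsDensityMatrix {n : ℕ} (ρ : Matrix (Fin n) (Fin n) ℝ) : Prop where
  posSemidef : ρ.PosSemidef
  trace_eq_one : ρ.trace = 1

/-- The Bures distance `D_B(ρ₁, ρ₂)`, given by
`D_B² = 2 (1 - tr √(ρ₁^{1/2} ρ₂ ρ₁^{1/2}))`, where `CFC.sqrt` is the positive semidefinite
square root of a positive semidefinite matrix. -/
noncomputable def buresDist {n : ℕ} (ρ₁ ρ₂ : Matrix (Fin n) (Fin n) ℝ) : ℝ :=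
  Real.sqrt (2 * (1 - (CFC.sqrt (CFC.sqrt ρ₁ * ρ₂ * CFC.sqrt ρ₁)).trace))

/-- The density matrices of rank exactly `k`. -/
def rankDensityMatrices (n k : ℕ) : Set (Matrix (Fin n) (Fin n) ℝ) :=
  {ρ | IsDensityMatrix ρ ∧ ρ.rank = k}

/-- The renormalized truncation `(∑_{i ≤ k} lam_i u_i u_iᵀ) / (∑_{i ≤ k} lam_i)`, where `u_i` is the
`i`-th column of `U`. Indices start at `0`, so the first `k` of them are those with `i < k`. -/
noncomputable def topTruncation {n : ℕ} (k : ℕ) (U : Matrix (Fin n) (Fin n) ℝ) (lam : Fin n → ℝ) :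
    Matrix (Fin n) (Fin n) ℝ :=
  (∑ i ∈ Finset.univ.filter (fun i : Fin n => (i : ℕ) < k), lam i)⁻¹ •
    ∑ i ∈ Finset.univ.filter (fun i : Fin n => (i : ℕ) < k), lam i • Matrix.vecMulVec (U.col i) (U.col i)

/-! Minimizing the distance means maximizing the fidelity `F = tr √(A B² A)`, with `A = √ρ` and `B =
√ρ₀`. Polar decomposition of `B A` gives a partial isometry `W` with `F = ⟨B W, A⟩` in the Frobenius
product (`exists_partialIsometry_trace_sqrt`). Since `‖A‖ = 1`, Cauchy–Schwarz yields `F² ≤ ‖B W‖² =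
tr (ρ₀ W Wᵀ)`. As `W Wᵀ` is an orthogonal projection of rank at most `k`, Ky Fan's principle
(`sum_mul_le_headSum`) bounds this by `s = λ₁ + ⋯ + λₖ`, and the truncation attains `F = √s`.

For uniqueness, both inequalities become equalities: under the gap, Ky Fan forces `W Wᵀ` to be the
leading spectral projection, and Cauchy–Schwarz gives `B W = F A`, whence `s ρ = B W Wᵀ B`. -/

namespace Matrix

variable {m : Type*} [Fintype m]

/-- Cauchy–Schwarz with its exact remainder, the part of `X` orthogonal to the unit vector `A`; the
remainder also settles the equality case. -/
lemma trace_transpose_mul_self_sub_sq (X A : Matrix m m ℝ) (hA : (Aᵀ * A).trace = 1) :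
    (Xᵀ * X).trace - (Xᵀ * A).trace ^ 2 =
      ((X - (Xᵀ * A).trace • A)ᵀ * (X - (Xᵀ * A).trace • A)).trace := by
  have h : (Aᵀ * X).trace = (Xᵀ * A).trace := by
    rw [← trace_transpose, transpose_mul, transpose_transpose]
  simp only [transpose_sub, transpose_smul, Matrix.sub_mul, Matrix.mul_sub, trace_sub, Matrix.smul_mul,
    Matrix.mul_smul, trace_smul, smul_eq_mul, h, hA]
  ring

lemma trace_transpose_mul_self_nonneg (X : Matrix m m ℝ) : 0 ≤ (Xᵀ * X).trace := by
  simpa using (posSemidef_conjTranspose_mul_self X).trace_nonneg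

lemma eq_zero_of_trace_transpose_mul_self_eq_zero {X : Matrix m m ℝ}
    (h : (Xᵀ * X).trace = 0) : X = 0 := by
  rw [← conjTranspose_eq_transpose_of_trivial] at h
  exact trace_conjTranspose_mul_self_eq_zero_iff.mp h

/-! ### Diagonal entries of orthogonal projections. -/

section SymmetricIdempotent

variable {R : Matrix m m ℝ}

lemma diag_eq_sum_sq (hRt : Rᵀ = R) (hRR : R * R = R) (i : m) : R i i = ∑ j, R i j ^ 2 := by
  have h := congrFun (congrFun hRR i) i
  rw [mul_apply] at h
  rw [← h]
  refine Finset.sum_congr rfl fun j _ => ?_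
  rw [sq, ← congrFun (congrFun hRt i) j, transpose_apply]

lemma diag_nonneg_of_idempotent (hRt : Rᵀ = R) (hRR : R * R = R) (i : m) : 0 ≤ R i i := by
  rw [diag_eq_sum_sq hRt hRR]; positivity

lemma diag_le_one_of_idempotent (hRt : Rᵀ = R) (hRR : R * R = R) (i : m) : R i i ≤ 1 := by
  have h : R i i ^ 2 ≤ R i i := by
    conv_rhs => rw [diag_eq_sum_sq hRt hRR]
    exact Finset.single_le_sum (f := fun j => R i j ^ 2) (fun j _ => sq_nonneg _)
      (Finset.mem_univ i)
  nlinarith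

end SymmetricIdempotent

/-! ### Pseudo-inverse and polar decomposition. -/

variable [DecidableEq m]

/-- A real symmetric matrix has a symmetric commuting pseudo-inverse, and the trace of the
resulting support projection is the rank. -/
lemma IsHermitian.exists_pseudoinverse {S : Matrix m m ℝ} (hS : S.IsHermitian) :
    ∃ T : Matrix m m ℝ, Tᵀ = T ∧ S * T = T * S ∧ T * S * T = T ∧ S * T * S = S ∧
      (T * S).trace = S.rank := by
  set φ := Unitary.conjStarAlgAut ℝ (Matrix m m ℝ) hS.eigenvectorUnitary with hφ
  set d := hS.eigenvalues with hd
  have hSφ : S = φ (diagonal d) := hS.spectral_theorem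
  have htr (X : Matrix m m ℝ) : (φ X).trace = X.trace := by
    rw [hφ, Unitary.conjStarAlgAut_apply, trace_mul_comm, ← mul_assoc]
    simp
  have hdiag (a : ℝ) : a⁻¹ * a * a⁻¹ = a⁻¹ := by
    by_cases h : a = 0 <;> simp [h]
  -- The convention `0⁻¹ = 0` makes this the pseudo-inverse on the kernel.
  refine ⟨φ (diagonal fun i => (d i)⁻¹), ?_, ?_, ?_, ?_, ?_⟩
  · have h := map_star φ (diagonal fun i => (d i)⁻¹)
    rw [star_eq_conjTranspose, star_eq_conjTranspose, conjTranspose_eq_transpose_of_trivial,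
      conjTranspose_eq_transpose_of_trivial, diagonal_transpose] at h
    exact h.symm
  · rw [hSφ, ← map_mul, ← map_mul, diagonal_mul_diagonal, diagonal_mul_diagonal]
    simp only [mul_comm]
  · rw [hSφ, ← map_mul, ← map_mul, diagonal_mul_diagonal, diagonal_mul_diagonal]
    simp only [hdiag]
  · rw [hSφ, ← map_mul, ← map_mul, diagonal_mul_diagonal, diagonal_mul_diagonal]
    simp only [mul_inv_mul_cancel]
  · rw [hS.rank_eq_card_non_zero_eigs]
    conv_lhs => rw [hSφ, ← map_mul, diagonal_mul_diagonal, htr, trace_diagonal]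
    rw [Fintype.card_subtype, Finset.card_filter, Nat.cast_sum]
    refine Finset.sum_congr rfl fun i _ => ?_
    by_cases h : d i = 0
    · simp [h, ← hd]
    · simp [h, ← hd]

/-- The trace of `√(A B² A)` is attained by pairing `B A` with a partial isometry `W` whose rank
is at most that of `A`. -/
lemma exists_partialIsometry_trace_sqrt (A B : Matrix m m ℝ) (hA : Aᵀ = A) (hB : Bᵀ = B) :
    ∃ W : Matrix m m ℝ, (W * Wᵀ) * (W * Wᵀ) = W * Wᵀ ∧ (W * Wᵀ).trace ≤ A.rank ∧
      (CFC.sqrt (A * (B * B) * A)).trace = (Wᵀ * (B * A)).trace := by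
  set S := CFC.sqrt (A * (B * B) * A) with hSdef
  have hnn : 0 ≤ A * (B * B) * A := by
    rw [nonneg_iff_posSemidef]
    have h := posSemidef_conjTranspose_mul_self (B * A)
    rwa [conjTranspose_eq_transpose_of_trivial, transpose_mul, hA, hB,
      show A * B * (B * A) = A * (B * B) * A by noncomm_ring] at h
  have hSS : S * S = A * (B * B) * A := CFC.sqrt_mul_sqrt_self _ hnn
  have hSpos : S.PosSemidef := nonneg_iff_posSemidef.mp (CFC.sqrt_nonneg _)
  have hSt : Sᵀ = S := hSpos.isHermitian
  obtain ⟨T, hT, hcomm, hTST, hSTS, htr⟩ := hSpos.isHermitian.exists_pseudoinverse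
  have hWt : (B * A * T)ᵀ = T * A * B := by
    rw [transpose_mul, transpose_mul, hA, hB, hT, mul_assoc]
  -- Here `S = |B A|`, so `W = B A T` is its polar factor and `Wᵀ W` the support projection of `S`.
  have hWW : (B * A * T)ᵀ * (B * A * T) = T * S := by
    calc (B * A * T)ᵀ * (B * A * T) = T * (A * (B * B) * A) * T := by
          rw [hWt]; noncomm_ring
      _ = T * S * (S * T) := by rw [← hSS]; noncomm_ring
      _ = T * S := by rw [hcomm, ← mul_assoc, hTST]
  refine ⟨B * A * T, ?_, ?_, ?_⟩
  · calc _ = (B * A * T) * ((B * A * T)ᵀ * (B * A * T)) * (B * A * T)ᵀ := by noncomm_ring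
      _ = B * A * (T * S * T) * (B * A * T)ᵀ := by
          rw [hWW, mul_assoc T S T, hcomm]; noncomm_ring
      _ = _ := by rw [hTST]
  · rw [trace_mul_comm, hWW, htr]
    have h : S.rank ≤ A.rank := by
      rw [← rank_transpose_mul_self S, hSt, hSS]
      exact rank_mul_le_right _ _
    exact_mod_cast h
  · rw [hWt, show T * A * B * (B * A) = T * (A * (B * B) * A) by noncomm_ring, ← hSS, ← mul_assoc,
      ← hcomm, hSTS]

/-- A symmetric idempotent whose diagonal entries are `0` or `1` is diagonal. -/
lemma eq_diagonal_of_idempotent {R : Matrix m m ℝ} (hRt : Rᵀ = R) (hRR : R * R = R) {e : m → ℝ}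
    (he : ∀ i, e i ^ 2 = e i) (hRe : ∀ i, R i i = e i) : R = diagonal e := by
  ext i j
  by_cases hij : i = j
  · subst hij; simp [hRe]
  · rw [diagonal_apply_ne _ hij]
    -- Since `R i i = (R i i)²`, the diagonal entry exhausts the sum of squares of its row.
    have h := diag_eq_sum_sq hRt hRR i
    rw [← Finset.add_sum_erase _ _ (Finset.mem_univ i), hRe, he, left_eq_add,
      Finset.sum_eq_zero_iff_of_nonneg fun _ _ => sq_nonneg _] at h
    simpa using h j (Finset.mem_erase.mpr ⟨Ne.symm hij, Finset.mem_univ j⟩)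

/-! ### Calculus in a fixed orthonormal eigenbasis. -/

section OrthogonalConjugation

variable {U : Matrix m m ℝ}

lemma conj_diagonal_mul (hU : Uᵀ * U = 1) (d e : m → ℝ) :
    (U * diagonal d * Uᵀ) * (U * diagonal e * Uᵀ) = U * diagonal (fun i => d i * e i) * Uᵀ := by
  calc _ = U * diagonal d * (Uᵀ * U) * diagonal e * Uᵀ := by noncomm_ring
    _ = _ := by rw [hU, mul_one, mul_assoc U, diagonal_mul_diagonal]

lemma posSemidef_conj_diagonal {d : m → ℝ} (hd : ∀ i, 0 ≤ d i) :
    (U * diagonal d * Uᵀ).PosSemidef := by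
  simpa using (PosSemidef.diagonal (R := ℝ) hd).mul_mul_conjTranspose_same U

lemma trace_conj_diagonal (hU : Uᵀ * U = 1) (d : m → ℝ) :
    (U * diagonal d * Uᵀ).trace = ∑ i, d i := by
  rw [trace_mul_comm, ← mul_assoc, hU, one_mul, trace_diagonal]

lemma rank_conj_diagonal (hU : Uᵀ * U = 1) (d : m → ℝ) :
    (U * diagonal d * Uᵀ).rank = Fintype.card {i // d i ≠ 0} := by
  have h : IsUnit U.det := isUnit_det_of_left_inverse hU
  rw [rank_mul_eq_left_of_isUnit_det _ _ (by rwa [det_transpose]),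
    rank_mul_eq_right_of_isUnit_det _ _ h, rank_diagonal]

lemma sqrt_conj_diagonal (hU : Uᵀ * U = 1) {d : m → ℝ} (hd : ∀ i, 0 ≤ d i) :
    CFC.sqrt (U * diagonal d * Uᵀ) = U * diagonal (fun i => √(d i)) * Uᵀ := by
  refine CFC.sqrt_unique ?_ (posSemidef_conj_diagonal fun i => Real.sqrt_nonneg _).nonneg
  rw [conj_diagonal_mul hU]
  simp only [Real.mul_self_sqrt (hd _)]

end OrthogonalConjugation

end Matrix

/-- The sum of the `k` first values of a sequence of length `n`. -/
noncomputable def headSum {n : ℕ} (k : ℕ) (lam : Fin n → ℝ) : ℝ :=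
  ∑ i ∈ Finset.univ.filter (fun i : Fin n => (i : ℕ) < k), lam i

/-! ### Ky Fan's inequality for weights in `[0, 1]`. -/

section Weights

variable {n k : ℕ} {lam q : Fin n → ℝ}

lemma headSum_eq (k : ℕ) (lam : Fin n → ℝ) :
    headSum k lam = ∑ i : Fin n, lam i * if (i : ℕ) < k then 1 else 0 := by
  simp [headSum, Finset.sum_filter]

lemma sum_ite_lt (hkn : k ≤ n) : ∑ i : Fin n, (if (i : ℕ) < k then (1 : ℝ) else 0) = k := by
  rw [Finset.sum_boole, Fin.card_filter_val_lt, min_eq_right hkn]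

/-- Recentring at a threshold `c`: for `c` the last retained value, both summands on the right are
nonnegative. -/
lemma headSum_sub_eq (hkn : k ≤ n) (lam q : Fin n → ℝ) (c : ℝ) :
    headSum k lam - ∑ i, lam i * q i =
      ∑ i : Fin n, (lam i - c) * ((if (i : ℕ) < k then 1 else 0) - q i) +
        c * (k - ∑ i, q i) := by
  rw [headSum_eq, ← sum_ite_lt hkn, ← Finset.sum_sub_distrib, ← Finset.sum_sub_distrib,
    Finset.mul_sum, ← Finset.sum_add_distrib]
  exact Finset.sum_congr rfl fun i _ => by ring

lemma head_gap_mul_nonneg (hlam : Antitone lam) (hq0 : ∀ i, 0 ≤ q i) (hq1 : ∀ i, q i ≤ 1)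
    (l : Fin n) (hl : (l : ℕ) + 1 = k) (i : Fin n) :
    0 ≤ (lam i - lam l) * ((if (i : ℕ) < k then 1 else 0) - q i) := by
  split_ifs with h
  · exact mul_nonneg (sub_nonneg.mpr (hlam (Fin.le_def.mpr (by omega)))) (sub_nonneg.mpr (hq1 i))
  · exact mul_nonneg_of_nonpos_of_nonpos
      (sub_nonpos.mpr (hlam (Fin.le_def.mpr (by omega)))) (by linarith [hq0 i])

lemma sum_mul_le_headSum (hlam : Antitone lam) (hpos : ∀ i, 0 ≤ lam i)
    (hk : 1 ≤ k) (hkn : k ≤ n) (hq0 : ∀ i, 0 ≤ q i) (hq1 : ∀ i, q i ≤ 1) (hq : ∑ i, q i ≤ k) :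
    ∑ i, lam i * q i ≤ headSum k lam := by
  let l : Fin n := ⟨k - 1, by omega⟩
  have h1 := Finset.sum_nonneg fun i (_ : i ∈ Finset.univ) =>
    head_gap_mul_nonneg hlam hq0 hq1 l (Nat.sub_add_cancel hk) i
  have h2 := mul_nonneg (hpos l) (sub_nonneg.mpr hq)
  linarith [headSum_sub_eq hkn lam q (lam l)]

/-- Both summands of `headSum_sub_eq` vanish. Positivity of the threshold gives total weight `k`,
and the gap kills the tail weights. Ties with the threshold leave head weights undetermined
termwise, but `k` weights at most `1` with sum `k` are all `1`. -/
lemma eq_ite_of_sum_mul_eq_headSum (hlam : Antitone lam)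
    (hpos : ∀ i : Fin n, (i : ℕ) < k → 0 < lam i)
    (hgap : ∀ i j : Fin n, (i : ℕ) < k → k ≤ (j : ℕ) → lam j < lam i)
    (hk : 1 ≤ k) (hkn : k ≤ n) (hq0 : ∀ i, 0 ≤ q i) (hq1 : ∀ i, q i ≤ 1) (hq : ∑ i, q i ≤ k)
    (heq : ∑ i, lam i * q i = headSum k lam) (i : Fin n) :
    q i = if (i : ℕ) < k then 1 else 0 := by
  let l : Fin n := ⟨k - 1, by omega⟩
  have hlk : (l : ℕ) < k := Nat.sub_lt hk one_pos
  have hterm := fun i (_ : i ∈ Finset.univ) =>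
    head_gap_mul_nonneg hlam hq0 hq1 l (Nat.sub_add_cancel hk) i
  have h1 := Finset.sum_nonneg hterm
  have h2 := mul_nonneg (hpos l hlk).le (sub_nonneg.mpr hq)
  have h3 := headSum_sub_eq hkn lam q (lam l)
  rw [heq, sub_self] at h3
  have hsum : ∑ i, q i = k := by
    have : lam l * (k - ∑ i, q i) = 0 := by linarith
    linarith [(mul_eq_zero.mp this).resolve_left (hpos l hlk).ne']
  have hzero := (Finset.sum_eq_zero_iff_of_nonneg hterm).mp (by linarith)
  have htail (j : Fin n) (hj : k ≤ (j : ℕ)) : q j = 0 := by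
    have := (mul_eq_zero.mp (hzero j (Finset.mem_univ j))).resolve_left
      (sub_neg.mpr (hgap l j hlk hj)).ne
    simpa [not_lt.mpr hj] using this
  have hle : ∀ j ∈ Finset.univ, q j ≤ if (j : ℕ) < k then 1 else 0 := fun j _ => by
    split_ifs with h
    · exact hq1 j
    · exact (htail j (not_lt.mp h)).le
  exact (Finset.sum_eq_sum_iff_of_le hle).mp (by rw [hsum, sum_ite_lt hkn]) i (Finset.mem_univ i)

end Weights

/-! ### Fidelity bound and its equality case. -/

section Bures

open Matrix

variable {n k : ℕ} {ρ₀ U : Matrix (Fin n) (Fin n) ℝ} {lam : Fin n → ℝ}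

/-- The square-root fidelity `tr √(√ρ₁ ρ₂ √ρ₁)`. -/
noncomputable def sqrtFidelity (ρ₁ ρ₂ : Matrix (Fin n) (Fin n) ℝ) : ℝ :=
  (CFC.sqrt (CFC.sqrt ρ₁ * ρ₂ * CFC.sqrt ρ₁)).trace

lemma topTruncation_eq (k : ℕ) (U : Matrix (Fin n) (Fin n) ℝ) (lam : Fin n → ℝ) :
    topTruncation k U lam =
      U * diagonal (fun i : Fin n => if (i : ℕ) < k then lam i / headSum k lam else 0) * Uᵀ := by
  ext a b
  rw [topTruncation, mul_apply]
  simp only [mul_diagonal, Matrix.smul_apply, Matrix.sum_apply, vecMulVec_apply, smul_eq_mul, transpose_apply,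
    Finset.mul_sum, col_apply]
  rw [Finset.sum_filter]
  refine Finset.sum_congr rfl fun i _ => ?_
  split_ifs
  · rw [headSum, Finset.sum_filter]; ring
  · ring

/-- A density matrix of rank at most `k` has square-root fidelity at most the root of the sum of
the `k` largest eigenvalues; the optimum forces the leading spectral projection. -/
lemma sqrtFidelity_bound {ρ : Matrix (Fin n) (Fin n) ℝ} (hρ : IsDensityMatrix ρ)
    (hρk : ρ.rank ≤ k) (hU : Uᵀ * U = 1) (hlam : Antitone lam) (hpos : ∀ i, 0 ≤ lam i)
    (hk : 1 ≤ k) (hkn : k ≤ n) :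
    sqrtFidelity ρ (U * diagonal lam * Uᵀ) ^ 2 ≤ headSum k lam ∧
    ((∀ i : Fin n, (i : ℕ) < k → 0 < lam i) →
      (∀ i j : Fin n, (i : ℕ) < k → k ≤ (j : ℕ) → lam j < lam i) →
      sqrtFidelity ρ (U * diagonal lam * Uᵀ) ^ 2 = headSum k lam →
      headSum k lam • ρ =
        U * diagonal (fun i : Fin n => lam i * if (i : ℕ) < k then 1 else 0) * Uᵀ) := by
  have hUU : U * Uᵀ = 1 := mul_eq_one_comm.mp hU
  set A := CFC.sqrt ρ with hAdef
  have hAA : A * A = ρ := CFC.sqrt_mul_sqrt_self _ hρ.posSemidef.nonneg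
  have hAt : Aᵀ = A := (CFC.sqrt_nonneg ρ).posSemidef.isHermitian
  have hAtr : (Aᵀ * A).trace = 1 := by rw [hAt, hAA, hρ.trace_eq_one]
  have hArank : A.rank ≤ k := by
    rwa [← rank_transpose_mul_self, hAt, hAA]
  set B := U * diagonal (fun i => √(lam i)) * Uᵀ with hBdef
  have hBB : B * B = U * diagonal lam * Uᵀ := by
    rw [hBdef, conj_diagonal_mul hU]
    simp only [Real.mul_self_sqrt (hpos _)]
  have hBt : Bᵀ = B := (posSemidef_conj_diagonal fun i => Real.sqrt_nonneg (lam i)).isHermitian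
  obtain ⟨W, hWW, hWtr, hf⟩ := exists_partialIsometry_trace_sqrt A B hAt hBt
  set R := Uᵀ * (W * Wᵀ) * U with hRdef
  have hRt : Rᵀ = R := by
    simp only [hRdef, transpose_mul, transpose_transpose, mul_assoc]
  have hRR : R * R = R := by
    calc R * R = Uᵀ * ((W * Wᵀ) * (U * Uᵀ) * (W * Wᵀ)) * U := by rw [hRdef]; noncomm_ring
      _ = R := by rw [hUU, mul_one, hWW]
  have hQ : W * Wᵀ = U * R * Uᵀ := by
    calc W * Wᵀ = (U * Uᵀ) * (W * Wᵀ) * (U * Uᵀ) := by rw [hUU, one_mul, mul_one]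
      _ = _ := by rw [hRdef]; noncomm_ring
  have hRtr : ∑ i, R i i ≤ k := by
    change R.trace ≤ k
    rw [hRdef, trace_mul_comm, ← mul_assoc, hUU, one_mul]
    exact hWtr.trans (by exact_mod_cast hArank)
  have hfid : sqrtFidelity ρ (U * diagonal lam * Uᵀ) = ((B * W)ᵀ * A).trace := by
    rw [sqrtFidelity, ← hAdef, ← hBB, hf, transpose_mul B W, hBt, mul_assoc Wᵀ]
  have hsum : ((B * W)ᵀ * (B * W)).trace = ∑ i, lam i * R i i := by
    rw [trace_mul_comm, transpose_mul, hBt,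
      show B * W * (Wᵀ * B) = B * (W * Wᵀ * B) by noncomm_ring, trace_mul_comm,
      mul_assoc, hBB, trace_mul_comm,
      show U * diagonal lam * Uᵀ * (W * Wᵀ) = U * (diagonal lam * (Uᵀ * (W * Wᵀ))) by noncomm_ring,
      trace_mul_comm, mul_assoc, ← hRdef, trace]
    simp [diagonal_mul]
  have hcs := trace_transpose_mul_self_sub_sq (B * W) A hAtr
  rw [← hfid, hsum] at hcs
  have hR0 := diag_nonneg_of_idempotent hRt hRR
  have hR1 := diag_le_one_of_idempotent hRt hRR
  have hky := sum_mul_le_headSum hlam hpos hk hkn hR0 hR1 hRtr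
  have hnn := trace_transpose_mul_self_nonneg
    (B * W - sqrtFidelity ρ (U * diagonal lam * Uᵀ) • A)
  refine ⟨by linarith, fun hpos' hgap heq => ?_⟩
  have hq := eq_ite_of_sum_mul_eq_headSum hlam hpos' hgap hk hkn hR0 hR1 hRtr (by linarith)
  have hRe := eq_diagonal_of_idempotent hRt hRR (fun i => by split_ifs <;> simp) hq
  -- The chain `F² ≤ ∑ λᵢ Rᵢᵢ ≤ s` collapses, so the Cauchy–Schwarz remainder is zero.
  have hBW := sub_eq_zero.mp
    (eq_zero_of_trace_transpose_mul_self_eq_zero (hcs.symm.trans (by linarith)))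
  calc headSum k lam • ρ = (B * W) * (B * W)ᵀ := by
        rw [hBW, transpose_smul, hAt, Matrix.smul_mul, Matrix.mul_smul, smul_smul, ← sq, heq, hAA]
    _ = B * (W * Wᵀ) * B := by rw [transpose_mul, hBt]; noncomm_ring
    _ = _ := by
        rw [hQ, hRe, hBdef, conj_diagonal_mul hU, conj_diagonal_mul hU]
        congr 3
        ext i
        linear_combination (if (i : ℕ) < k then (1 : ℝ) else 0) * Real.mul_self_sqrt (hpos i)

lemma sqrtFidelity_topTruncation (hU : Uᵀ * U = 1) (hpos : ∀ i, 0 ≤ lam i)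
    (hs : 0 < headSum k lam) :
    sqrtFidelity (topTruncation k U lam) (U * diagonal lam * Uᵀ) = √(headSum k lam) := by
  set s := headSum k lam with hsdef
  have hd (i : Fin n) : 0 ≤ if (i : ℕ) < k then lam i / s else 0 := by
    split_ifs
    · exact div_nonneg (hpos i) hs.le
    · exact le_rfl
  rw [sqrtFidelity, topTruncation_eq, sqrt_conj_diagonal hU hd, conj_diagonal_mul hU,
    conj_diagonal_mul hU]
  have hprod (i : Fin n) : √(if (i : ℕ) < k then lam i / s else 0) * lam i *
      √(if (i : ℕ) < k then lam i / s else 0) =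
        (lam i * (if (i : ℕ) < k then 1 else 0) / √s) ^ 2 := by
    rw [mul_right_comm, Real.mul_self_sqrt (hd i), div_pow, Real.sq_sqrt hs.le]
    split_ifs <;> ring
  have hn (i : Fin n) : 0 ≤ lam i * (if (i : ℕ) < k then 1 else 0) / √s := by
    have := hpos i
    split_ifs <;> positivity
  simp only [hprod]
  rw [sqrt_conj_diagonal hU fun i => sq_nonneg _, trace_conj_diagonal hU]
  simp only [Real.sqrt_sq (hn _)]
  rw [← Finset.sum_div, ← headSum_eq, ← hsdef, Real.div_sqrt]

lemma topTruncation_mem (hU : Uᵀ * U = 1) (hpos : ∀ i, 0 ≤ lam i) (hkn : k ≤ n)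
    (hpos' : ∀ i : Fin n, (i : ℕ) < k → 0 < lam i) (hs : 0 < headSum k lam) :
    topTruncation k U lam ∈ rankDensityMatrices n k := by
  rw [topTruncation_eq]
  refine ⟨⟨posSemidef_conj_diagonal fun i => ?_, ?_⟩, ?_⟩
  · split_ifs
    · exact div_nonneg (hpos i) hs.le
    · exact le_rfl
  · rw [trace_conj_diagonal hU, ← Finset.sum_filter, ← Finset.sum_div]
    exact div_self hs.ne'
  · rw [rank_conj_diagonal hU, Fintype.card_subtype]
    have h (i : Fin n) : (if (i : ℕ) < k then lam i / headSum k lam else 0) ≠ 0 ↔ (i : ℕ) < k := by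
      by_cases hi : (i : ℕ) < k
      · simp [hi, (hpos' i hi).ne', hs.ne']
      · simp [hi]
    simp only [h, Fin.card_filter_val_lt, min_eq_right hkn]

/-- If `lam i = 0`, monotonicity kills all later eigenvalues, leaving rank at most `i`. -/
lemma pos_of_lt_rank (hU : Uᵀ * U = 1) (hlam : Antitone lam) (hpos : ∀ i, 0 ≤ lam i)
    {i : Fin n} (hi : (i : ℕ) < (U * diagonal lam * Uᵀ).rank) : 0 < lam i := by
  refine (hpos i).lt_of_ne' fun h0 => hi.not_ge ?_
  rw [rank_conj_diagonal hU, Fintype.card_subtype]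
  refine (Finset.card_le_card (t := Finset.univ.filter fun j : Fin n => (j : ℕ) < i)
    fun j hj => ?_).trans (by rw [Fin.card_filter_val_lt]; exact min_le_right _ _)
  simp only [Finset.mem_filter, Finset.mem_univ, true_and] at hj ⊢
  by_contra hij
  exact hj (le_antisymm (h0 ▸ hlam (Fin.le_def.mpr (not_lt.mp hij))) (hpos j))

lemma eigenvalue_nonneg (hU : Uᵀ * U = 1) (h : (U * diagonal lam * Uᵀ).PosSemidef) (i : Fin n) :
    0 ≤ lam i := by
  have h' := h.conjTranspose_mul_mul_same U
  rw [conjTranspose_eq_transpose_of_trivial,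
    show Uᵀ * (U * diagonal lam * Uᵀ) * U = (Uᵀ * U) * diagonal lam * (Uᵀ * U) by noncomm_ring,
    hU, one_mul, mul_one] at h'
  exact posSemidef_diagonal_iff.mp h' i

end Bures

/-- The gap condition is vacuous for `k = n`; otherwise, as `lam` is antitone, it amounts to `λₖ >
λₖ₊₁`. -/
theorem theorem2 (n k : ℕ) (ρ₀ U : Matrix (Fin n) (Fin n) ℝ) (lam : Fin n → ℝ)
    (hρ₀ : IsDensityMatrix ρ₀)
    (hU : U ∈ Matrix.orthogonalGroup (Fin n) ℝ)
    (hlam : Antitone lam)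
    (hdecomp : ρ₀ = U * Matrix.diagonal lam * U.transpose)
    (hk : 1 ≤ k) (hkr : k ≤ ρ₀.rank) :
    topTruncation k U lam ∈ rankDensityMatrices n k ∧
    IsMinOn (fun ρ => buresDist ρ ρ₀) (rankDensityMatrices n k) (topTruncation k U lam) ∧
    ((∀ i j : Fin n, (i : ℕ) < k → k ≤ (j : ℕ) → lam j < lam i) →
      ∀ ρ ∈ rankDensityMatrices n k,
        IsMinOn (fun ρ' => buresDist ρ' ρ₀) (rankDensityMatrices n k) ρ →
          ρ = topTruncation k U lam) := by
  subst hdecomp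
  have hUt : U.transpose * U = 1 := (Matrix.mem_orthogonalGroup_iff' _ _).mp hU
  have hpos := eigenvalue_nonneg hUt hρ₀.posSemidef
  have hkn : k ≤ n := hkr.trans (Matrix.rank_le_width _)
  have hpos' (i : Fin n) (hi : (i : ℕ) < k) : 0 < lam i :=
    pos_of_lt_rank hUt hlam hpos (hi.trans_le hkr)
  have hs : 0 < headSum k lam :=
    Finset.sum_pos (fun i hi => hpos' i (Finset.mem_filter.mp hi).2)
      ⟨⟨0, by omega⟩, Finset.mem_filter.mpr ⟨Finset.mem_univ _, hk⟩⟩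
  have hs1 : headSum k lam ≤ 1 := by
    rw [← hρ₀.trace_eq_one, Matrix.trace_conj_diagonal hUt]
    exact Finset.sum_le_sum_of_subset_of_nonneg (Finset.filter_subset _ _) fun i _ _ => hpos i
  have hmem := topTruncation_mem hUt hpos hkn hpos' hs
  have htop := sqrtFidelity_topTruncation hUt hpos hs
  have hdist (ρ ρ' : Matrix (Fin n) (Fin n) ℝ) :
      buresDist ρ ρ' = √(2 * (1 - sqrtFidelity ρ ρ')) := rfl
  refine ⟨hmem, fun ρ hρ => ?_, fun hgap ρ hρ hmin => ?_⟩
  · have h := (sqrtFidelity_bound hρ.1 hρ.2.le hUt hlam hpos hk hkn).1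
    have := Real.le_sqrt_of_sq_le h
    change buresDist _ _ ≤ buresDist _ _
    rw [hdist, hdist, htop]
    exact Real.sqrt_le_sqrt (by linarith)
  · obtain ⟨hle, huniq⟩ := sqrtFidelity_bound hρ.1 hρ.2.le hUt hlam hpos hk hkn
    have hm : buresDist ρ _ ≤ buresDist (topTruncation k U lam) _ := hmin hmem
    -- `Real.sqrt` truncates negative numbers to `0`, so comparing radicands needs `1 - √s ≥ 0`.
    have hsqrt : √(headSum k lam) ≤ 1 := Real.sqrt_le_one.mpr hs1
    rw [hdist, hdist, htop, Real.sqrt_le_sqrt_iff (by linarith)] at hm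
    have hge : √(headSum k lam) ^ 2 ≤ _ :=
      pow_le_pow_left₀ (Real.sqrt_nonneg _) (by linarith) 2
    rw [Real.sq_sqrt hs.le] at hge
    have hρs := huniq hpos' hgap (hle.antisymm hge)
    rw [topTruncation_eq, ← inv_smul_smul₀ hs.ne' ρ, hρs, ← Matrix.smul_mul, ← Matrix.mul_smul,
      ← Matrix.diagonal_smul]
    congr 3
    ext i
    simp only [Pi.smul_apply, smul_eq_mul]
    split_ifs <;> ring
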